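/- Let $D$ be an integral domain with field of fractions $K$. For a nonzero fractional ideal $I$ of $D$ put $I^{-1}=\{x\in K\mid xI\subseteq D\}$, $I_v=(I^{-1})^{-1}$, and $I_t=\bigcup_H H_v$, where $H$ ranges over the nonzero finitely generated fractional ideals of $D$ contained in $I$. The domain $D$ is called $t$-sharp if, whenever $I,A,B$ are nonzero ideals of $D$ with $I\supseteq AB$, there exist nonzero ideals $H,J$ of $D$ such that $I_t=(HJ)_t$, $H_t\supseteq A$ and $J_t\supseteq B$. A domain $R$ is called sharp if, whenever $I,A,B$ are nonzero ideals of $R$ with $I\supseteq AB$, there exist ideals $A'\supseteq A$ and $B'\supseteq B$ of $R$ such that $I=A'B'$. For $f\in D[X]$ let $c(f)$ be the ideal of $D$ generated by the coefficients of $f$, and let $N_v$ be the multiplicative set of all nonzero $f\in D[X]$ with $c(f)_v=D$. Then $D$ is $t$-sharp if and only if the ring of fractions $D[X]_{N_v}$ is sharp. -/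

import Mathlib

open scoped nonZeroDivisors Polynomial

section StarOperations

variable {D : Type*} [CommRing D] [IsDomain D] {K : Type*} [Field K] [Algebra D K]
  [IsFractionRing D K]

/-- The `v`-operation `I ↦ I_v = (I⁻¹)⁻¹`, where `I⁻¹ = (D : I) = {x ∈ K | x I ⊆ D}`.
(At the zero ideal the value is `0`.) -/
noncomputable def vClosure (I : FractionalIdeal D⁰ K) : FractionalIdeal D⁰ K := (I⁻¹)⁻¹

theorem fractionalIdeal_inv_antitone {I J : FractionalIdeal D⁰ K} (hI : I ≠ 0) (h : I ≤ J) :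
    J⁻¹ ≤ I⁻¹ := by
  have hJ : J ≠ 0 := fun h0 => hI (le_antisymm (h0 ▸ h) (FractionalIdeal.zero_le I))
  intro x hx
  rw [FractionalIdeal.mem_inv_iff hJ] at hx
  rw [FractionalIdeal.mem_inv_iff hI]
  exact fun y hy => hx y (h hy)

theorem fractionalIdeal_inv_ne_zero {I : FractionalIdeal D⁰ K} (hI : I ≠ 0) : I⁻¹ ≠ 0 := by
  obtain ⟨a, J, ha, rfl⟩ := FractionalIdeal.exists_eq_spanSingleton_mul I
  intro h0
  have ha' : algebraMap D K a ≠ 0 := by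
    simpa using ha
  have hmem : algebraMap D K a ∈ (FractionalIdeal.spanSingleton D⁰ (algebraMap D K a)⁻¹ *
      (J : FractionalIdeal D⁰ K))⁻¹ := by
    rw [FractionalIdeal.mem_inv_iff hI]
    intro y hy
    rw [FractionalIdeal.mem_singleton_mul] at hy
    obtain ⟨z, hz, rfl⟩ := hy
    rw [← mul_assoc, mul_inv_cancel₀ ha', one_mul]
    exact FractionalIdeal.coeIdeal_le_one hz
  rw [h0, FractionalIdeal.mem_zero_iff] at hmem
  exact ha' hmem

theorem vClosure_mono {I J : FractionalIdeal D⁰ K} (h : I ≤ J) : vClosure I ≤ vClosure J := by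
  by_cases hI : I = 0
  · subst hI
    rw [vClosure, FractionalIdeal.inv_zero', FractionalIdeal.inv_zero']
    exact FractionalIdeal.zero_le _
  · have hJ : J ≠ 0 := fun h0 => hI (le_antisymm (h0 ▸ h) (FractionalIdeal.zero_le I))
    exact fractionalIdeal_inv_antitone (fractionalIdeal_inv_ne_zero hJ)
      (fractionalIdeal_inv_antitone hI h)

/-- The `t`-operation: `I_t` is the union of the `H_v`, where `H` ranges over the finitely generated
fractional ideals contained in `I`.  (Allowing `H = 0` only contributes the element `0`.) -/
noncomputable def tClosure (I : FractionalIdeal D⁰ K) : FractionalIdeal D⁰ K where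
  val :=
    { carrier := {x | ∃ H : FractionalIdeal D⁰ K,
        (H : Submodule D K).FG ∧ H ≤ I ∧ x ∈ vClosure H}
      zero_mem' := ⟨0, by simpa using Submodule.fg_bot, FractionalIdeal.zero_le I,
        Submodule.zero_mem _⟩
      add_mem' := by
        rintro x y ⟨H, hH, hHI, hx⟩ ⟨H', hH', hHI', hy⟩
        refine ⟨H ⊔ H', ?_, sup_le hHI hHI', ?_⟩
        · rw [FractionalIdeal.coe_sup]
          exact hH.sup hH'
        · exact Submodule.add_mem _ (vClosure_mono le_sup_left hx) (vClosure_mono le_sup_right hy)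
      smul_mem' := by
        rintro c x ⟨H, hH, hHI, hx⟩
        exact ⟨H, hH, hHI, Submodule.smul_mem _ c hx⟩ }
  property := by
    refine FractionalIdeal.isFractional_of_le (J := vClosure I) ?_
    rintro x ⟨H, -, hHI, hx⟩
    exact vClosure_mono hHI hx

/-- `D` is `*`-sharp: whenever `I ⊇ A B` for nonzero ideals `I`, `A`, `B` of `D`, there are nonzero
ideals `H`, `J` of `D` with `I^* = (H J)^*`, `H^* ⊇ A` and `J^* ⊇ B`. -/
def IsStarSharp (star : FractionalIdeal D⁰ K → FractionalIdeal D⁰ K) : Prop :=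
  ∀ I A B : Ideal D, I ≠ ⊥ → A ≠ ⊥ → B ≠ ⊥ → A * B ≤ I →
    ∃ H J : Ideal D, H ≠ ⊥ ∧ J ≠ ⊥ ∧
      star (I : FractionalIdeal D⁰ K) = star ((H * J : Ideal D) : FractionalIdeal D⁰ K) ∧
      (A : FractionalIdeal D⁰ K) ≤ star (H : FractionalIdeal D⁰ K) ∧
      (B : FractionalIdeal D⁰ K) ≤ star (J : FractionalIdeal D⁰ K)

theorem vClosure_eq_one_iff {I : Ideal D} (hI : I ≠ ⊥) :
    vClosure (I : FractionalIdeal D⁰ K) = 1 ↔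
      ∀ x : K, (∀ y ∈ I, x * algebraMap D K y ∈ (algebraMap D K).range) →
        x ∈ (algebraMap D K).range := by
  have hI' : (I : FractionalIdeal D⁰ K) ≠ 0 := FractionalIdeal.coeIdeal_ne_zero.mpr hI
  have hmem : ∀ x : K, x ∈ (I : FractionalIdeal D⁰ K)⁻¹ ↔
      ∀ y ∈ I, x * algebraMap D K y ∈ (algebraMap D K).range := by
    intro x
    rw [FractionalIdeal.mem_inv_iff hI']
    constructor
    · intro h y hy
      have := h _ (FractionalIdeal.mem_coeIdeal_of_mem D⁰ hy)
      rw [FractionalIdeal.mem_one_iff] at this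
      exact this
    · intro h y hy
      rw [FractionalIdeal.mem_coeIdeal] at hy
      obtain ⟨z, hz, rfl⟩ := hy
      rw [FractionalIdeal.mem_one_iff]
      exact h z hz
  have h1 : (1 : FractionalIdeal D⁰ K) ≤ (I : FractionalIdeal D⁰ K)⁻¹ := by
    have := fractionalIdeal_inv_antitone hI' (FractionalIdeal.coeIdeal_le_one (I := I))
    rwa [inv_one] at this
  constructor
  · intro h x hx
    have hx' := (hmem x).mpr hx
    have hne : (I : FractionalIdeal D⁰ K)⁻¹ ≠ 0 := fractionalIdeal_inv_ne_zero hI'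
    have hone : (1 : K) ∈ vClosure (I : FractionalIdeal D⁰ K) := by
      rw [h]; exact FractionalIdeal.one_mem_one D⁰
    have := (FractionalIdeal.mem_inv_iff hne).mp hone x hx'
    rw [one_mul, FractionalIdeal.mem_one_iff] at this
    exact this
  · intro h
    have : (I : FractionalIdeal D⁰ K)⁻¹ = 1 := by
      refine le_antisymm ?_ h1
      intro x hx
      rw [FractionalIdeal.mem_one_iff]
      exact h x ((hmem x).mp hx)
    rw [vClosure, this, inv_one]

/-- If `f ∈ D[X]` has content with trivial inverse and `f h` has coefficients in `D`, then so
does `h ∈ K[X]`. -/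
theorem mem_range_of_mul_mem_range {f : D[X]}
    (hf : ∀ x : K, (∀ k, x * algebraMap D K (f.coeff k) ∈ (algebraMap D K).range) →
      x ∈ (algebraMap D K).range) (n : ℕ) :
    ∀ h : K[X], (∀ m, n ≤ m → h.coeff m = 0) →
      f.map (algebraMap D K) * h ∈ (Polynomial.mapRingHom (algebraMap D K)).range →
      h ∈ (Polynomial.mapRingHom (algebraMap D K)).range := by
  set T := (Polynomial.mapRingHom (algebraMap D K)).range with hT
  have hC : ∀ a : D, Polynomial.C (algebraMap D K a) ∈ T := fun a =>
    ⟨Polynomial.C a, by simp⟩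
  induction n with
  | zero =>
    intro h h0 _
    have : h = 0 := by
      ext m
      simpa using h0 m (Nat.zero_le m)
    rw [this]
    exact T.zero_mem
  | succ n ih =>
    intro h h0 hfh
    have key : ∀ d k : ℕ, f.natDegree < k + d →
        Polynomial.C (algebraMap D K (f.coeff k)) * h ∈ T := by
      intro d
      induction d with
      | zero =>
        intro k hk
        rw [Polynomial.coeff_eq_zero_of_natDegree_lt (by simpa using hk)]
        simp
      | succ d ihd =>
        intro k hk
        have hlead : algebraMap D K (f.coeff k) * h.coeff n ∈ (algebraMap D K).range := by
          have htot := (Polynomial.mem_map_range _).mp hfh (k + n)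
          rw [Polynomial.coeff_mul, ← Finset.add_sum_erase _ _
            (show (k, n) ∈ Finset.HasAntidiagonal.antidiagonal (k + n) by simp)] at htot
          have hrest : ∑ p ∈ (Finset.HasAntidiagonal.antidiagonal (k + n)).erase (k, n),
              (f.map (algebraMap D K)).coeff p.1 * h.coeff p.2 ∈ (algebraMap D K).range := by
            refine Subring.sum_mem _ ?_
            rintro ⟨i, j⟩ hij
            rw [Finset.mem_erase, Finset.HasAntidiagonal.mem_antidiagonal] at hij
            obtain ⟨hne, hsum⟩ := hij
            dsimp only at hsum ⊢
            by_cases hj : n + 1 ≤ j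
            · rw [h0 j hj, mul_zero]
              exact Subring.zero_mem _
            · have hik : k < i := by
                by_contra hcon
                apply hne
                rw [Prod.mk.injEq]
                omega
              have := (Polynomial.mem_map_range _).mp (ihd i (by omega)) j
              rw [Polynomial.coeff_C_mul] at this
              rwa [Polynomial.coeff_map]
          have := Subring.sub_mem _ htot hrest
          rw [add_sub_cancel_right, Polynomial.coeff_map] at this
          exact this
        have hmono : Polynomial.monomial n (algebraMap D K (f.coeff k) * h.coeff n) ∈ T := by
          obtain ⟨b, hb⟩ := hlead
          exact ⟨Polynomial.monomial n b, by simp [hb]⟩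
        have hdecomp : Polynomial.C (algebraMap D K (f.coeff k)) * h =
            Polynomial.monomial n (algebraMap D K (f.coeff k) * h.coeff n) +
              Polynomial.C (algebraMap D K (f.coeff k)) * h.erase n := by
          conv_lhs => rw [← Polynomial.monomial_add_erase h n]
          rw [mul_add, Polynomial.C_mul_monomial]
        have herase : Polynomial.C (algebraMap D K (f.coeff k)) * h.erase n ∈ T := by
          apply ih
          · intro m hm
            rw [Polynomial.coeff_C_mul, Polynomial.coeff_erase]
            split_ifs with hmn
            · simp
            · rw [h0 m (by omega), mul_zero]
          · have heq : f.map (algebraMap D K) *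
                (Polynomial.C (algebraMap D K (f.coeff k)) * h.erase n) =
                Polynomial.C (algebraMap D K (f.coeff k)) * (f.map (algebraMap D K) * h) -
                f.map (algebraMap D K) *
                  Polynomial.monomial n (algebraMap D K (f.coeff k) * h.coeff n) := by
              rw [mul_left_comm (Polynomial.C _) (f.map _) h, hdecomp]
              ring
            rw [heq]
            exact T.sub_mem (T.mul_mem (hC _) hfh) (T.mul_mem ⟨f, by simp⟩ hmono)
        rw [hdecomp]
        exact T.add_mem hmono herase
    rw [hT, Polynomial.mem_map_range]
    intro j
    apply hf
    intro k
    have := (Polynomial.mem_map_range _).mp (key (f.natDegree + 1) k (by omega)) j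
    rw [Polynomial.coeff_C_mul] at this
    rwa [mul_comm]

theorem vClosure_contentIdeal_eq_one_iff {f : D[X]} (hf : f ≠ 0) :
    vClosure (f.contentIdeal : FractionalIdeal D⁰ K) = 1 ↔
      ∀ x : K, (∀ k, x * algebraMap D K (f.coeff k) ∈ (algebraMap D K).range) →
        x ∈ (algebraMap D K).range := by
  rw [vClosure_eq_one_iff (by simpa using hf)]
  refine forall_congr' fun x => imp_congr_left ⟨fun h k => h _ (f.coeff_mem_contentIdeal k), ?_⟩
  intro h y hy
  rw [Polynomial.contentIdeal_def] at hy
  induction hy using Submodule.span_induction with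
  | mem y hy =>
    obtain ⟨k, -, rfl⟩ := Polynomial.mem_coeffs_iff.mp hy
    exact h k
  | zero => simp
  | add y z _ _ hy hz =>
    rw [map_add, mul_add]
    exact Subring.add_mem _ hy hz
  | smul a y _ hy =>
    rw [smul_eq_mul, map_mul, mul_left_comm]
    exact Subring.mul_mem _ ⟨a, rfl⟩ hy

end StarOperations

/-- `D` is `t`-sharp: it is `*`-sharp for the `t`-operation `* = t` on fractional ideals of `D`
in its field of fractions. -/
def IsTSharp (D : Type*) [CommRing D] [IsDomain D] : Prop :=
  IsStarSharp (tClosure : FractionalIdeal D⁰ (FractionRing D) → FractionalIdeal D⁰ (FractionRing D))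

/-- `R` is sharp: whenever `I ⊇ A B` for nonzero ideals `I`, `A`, `B` of `R`, there are ideals
`A' ⊇ A` and `B' ⊇ B` with `I = A' B'`. -/
def IsSharp (R : Type*) [CommRing R] : Prop :=
  ∀ I A B : Ideal R, I ≠ ⊥ → A ≠ ⊥ → B ≠ ⊥ → A * B ≤ I →
    ∃ A' B' : Ideal R, A ≤ A' ∧ B ≤ B' ∧ I = A' * B'

/-- The multiplicative set `N_v` of all nonzero `f ∈ D[X]` with `c(f)_v = D`. -/
noncomputable def Nv (D : Type*) [CommRing D] [IsDomain D] : Submonoid D[X] where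
  carrier := {f | f ≠ 0 ∧
    vClosure (f.contentIdeal : FractionalIdeal D⁰ (FractionRing D)) = 1}
  one_mem' := by
    refine ⟨one_ne_zero, ?_⟩
    rw [Polynomial.contentIdeal_one, FractionalIdeal.coeIdeal_top, vClosure, inv_one, inv_one]
  mul_mem' := by
    rintro f g ⟨hf0, hf⟩ ⟨hg0, hg⟩
    refine ⟨mul_ne_zero hf0 hg0, ?_⟩
    rw [vClosure_contentIdeal_eq_one_iff hf0] at hf
    rw [vClosure_contentIdeal_eq_one_iff hg0] at hg
    rw [vClosure_contentIdeal_eq_one_iff (mul_ne_zero hf0 hg0)]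
    intro x hx
    have h1 : g.map (algebraMap D (FractionRing D)) * Polynomial.C x ∈
        (Polynomial.mapRingHom (algebraMap D (FractionRing D))).range := by
      refine mem_range_of_mul_mem_range hf
        ((g.map (algebraMap D (FractionRing D)) * Polynomial.C x).natDegree + 1) _
        (fun m hm => Polynomial.coeff_eq_zero_of_natDegree_lt hm) ?_
      rw [← mul_assoc, ← Polynomial.map_mul, Polynomial.mem_map_range]
      intro k
      rw [Polynomial.coeff_mul_C, Polynomial.coeff_map, mul_comm]
      exact hx k
    have h2 := mem_range_of_mul_mem_range hg _ _
      (fun m hm => Polynomial.coeff_eq_zero_of_natDegree_lt (Nat.lt_of_succ_le hm)) h1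
    have := (Polynomial.mem_map_range _).mp h2 0
    rwa [Polynomial.coeff_C_zero] at this

/-! Let `R = D[X]_{N_v}`. If every finitely generated ideal of `D` is `t`-invertible (`D` is a
PvMD), then `I ↦ IR` identifies the ideals of `D` up to `t`-closure with the ideals of `R`,
respecting products and inclusions. The two sharpness conditions then say the same thing.

Either condition forces this `t`-invertibility. For `0 ≠ x ∈ A` and `B = (xD : A)`, factor `xD`, or
`xR`, along `AB ⊆ xD`. Each factor is bounded by a colon ideal, so `x ∈ ((xD : B)B)_t`, where `(xD :
B) = A_v`. When `A` is finitely generated, `A_v` can be replaced by `A`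
(`fgIdealsTInvertible_of_colon_colon`).

The correspondence rests on `FGIdealsTInvertible.exists_mul_eq`: `f b = x q` with `q` a unit of `R`
and the coefficients of `b` in `x c(f)⁻¹`. Hence `fR = c(f)R`. -/

namespace Ideal

/-! ### Closures and colon ideals inside `D` -/

variable {D : Type*} [CommRing D]

/-- The `v`-closure of an integral ideal, expressed by divisibility in the ring. -/
def divisorialClosure (H : Ideal D) : Ideal D where
  carrier := {x | ∀ a d : D, (∀ h ∈ H, d ∣ a * h) → d ∣ a * x}
  zero_mem' a d _ := by simp
  add_mem' {x y} hx hy a d h := by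
    rw [mul_add]
    exact dvd_add (hx a d h) (hy a d h)
  smul_mem' c x hx a d h := by
    rw [smul_eq_mul, mul_left_comm]
    exact (hx a d h).mul_left c

theorem divisorialClosure_mono {H J : Ideal D} (h : H ≤ J) :
    H.divisorialClosure ≤ J.divisorialClosure :=
  fun _ hx a d hd => hx a d fun y hy => hd y (h hy)

theorem le_divisorialClosure (H : Ideal D) : H ≤ H.divisorialClosure :=
  fun x hx _ _ hd => hd x hx

theorem divisorialClosure_idem {H J : Ideal D} (h : H ≤ J.divisorialClosure) :
    H.divisorialClosure ≤ J.divisorialClosure :=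
  fun _ hx a d hd => hx a d fun _ hy => h hy a d hd

/-- The `t`-closure of an integral ideal. -/
def tIdeal (I : Ideal D) : Ideal D where
  carrier := {x | ∃ H : Ideal D, H.FG ∧ H ≤ I ∧ x ∈ H.divisorialClosure}
  zero_mem' := ⟨⊥, Submodule.fg_bot, bot_le, zero_mem _⟩
  add_mem' := by
    rintro x y ⟨H, hH, hHI, hx⟩ ⟨J, hJ, hJI, hy⟩
    exact ⟨H ⊔ J, Submodule.FG.sup hH hJ, sup_le hHI hJI, add_mem (divisorialClosure_mono le_sup_left hx)
      (divisorialClosure_mono le_sup_right hy)⟩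
  smul_mem' := by
    rintro c x ⟨H, hH, hHI, hx⟩
    exact ⟨H, hH, hHI, Submodule.smul_mem _ c hx⟩

theorem tIdeal_mono {I J : Ideal D} (h : I ≤ J) : I.tIdeal ≤ J.tIdeal := by
  rintro x ⟨H, hH, hHI, hx⟩
  exact ⟨H, hH, hHI.trans h, hx⟩

theorem le_tIdeal (I : Ideal D) : I ≤ I.tIdeal := by
  intro x hx
  exact ⟨span {x}, Submodule.fg_span_singleton x, (span_singleton_le_iff_mem _).mpr hx,
    le_divisorialClosure _ (mem_span_singleton_self x)⟩

theorem tIdeal_le_divisorialClosure (I : Ideal D) : I.tIdeal ≤ I.divisorialClosure := by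
  rintro x ⟨H, -, hHI, hx⟩
  exact divisorialClosure_mono hHI hx

theorem mem_span_singleton_colon {x y : D} {A : Ideal D} :
    y ∈ (span {x}).colon (A : Set D) ↔ ∀ a ∈ A, x ∣ y * a := by
  simp [Submodule.mem_colon, mem_span_singleton]

theorem mul_span_singleton_colon_le (A : Ideal D) (x : D) :
    A * (span {x}).colon (A : Set D) ≤ span {x} := by
  rw [mul_comm, mul_le]
  intro b hb a ha
  rw [mem_span_singleton]
  exact mem_span_singleton_colon.mp hb a ha

/-- If `x` divides `c I`, then it divides `c I_t`. -/
theorem dvd_mul_of_mem_tIdeal {I : Ideal D} {x c y : D} (h : ∀ i ∈ I, x ∣ c * i)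
    (hy : y ∈ I.tIdeal) : x ∣ c * y :=
  tIdeal_le_divisorialClosure I hy c x h

theorem exists_fg_of_le_mul {A B L : Ideal D} (hL : L.FG) (h : L ≤ A * B) :
    ∃ G : Ideal D, G.FG ∧ G ≤ B ∧ L ≤ A * G := by
  have key : ∀ x ∈ A * B, ∃ G : Ideal D, G.FG ∧ G ≤ B ∧ x ∈ A * G := by
    intro x hx
    induction hx using Submodule.mul_induction_on' with
    | mem_mul_mem a ha b hb =>
      exact ⟨span {b}, Submodule.fg_span_singleton b, (span_singleton_le_iff_mem _).mpr hb,
        mul_mem_mul ha (mem_span_singleton_self b)⟩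
    | add x _ y _ hx hy =>
      obtain ⟨G, hG, hGB, hx⟩ := hx
      obtain ⟨G', hG', hGB', hy⟩ := hy
      exact ⟨G ⊔ G', Submodule.FG.sup hG hG', sup_le hGB hGB', add_mem (mul_mono_right le_sup_left hx)
        (mul_mono_right le_sup_right hy)⟩
  classical
  obtain ⟨S, rfl⟩ := hL
  induction S using Finset.induction_on with
  | empty => exact ⟨⊥, Submodule.fg_bot, bot_le, by simp⟩
  | insert s S _ ih =>
    rw [Finset.coe_insert, span_insert, sup_le_iff,
      span_singleton_le_iff_mem] at h
    obtain ⟨G, hG, hGB, hx⟩ := key s h.1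
    obtain ⟨G', hG', hGB', hy⟩ := ih h.2
    refine ⟨G ⊔ G', Submodule.FG.sup hG hG', sup_le hGB hGB', ?_⟩
    rw [Finset.coe_insert, span_insert, sup_le_iff, span_singleton_le_iff_mem]
    exact ⟨mul_mono_right le_sup_left hx, hy.trans (mul_mono_right le_sup_right)⟩

/-- The double colon is `A_v`, and `A_v G ⊆ (AG)_v`. If `d` divides `a A G`, then `ag/d ∈ A⁻¹` for
`g ∈ G`; multiplying by `x ∈ A` gives the integral element `b = agx/d` of `(xD : A)`, against which
`y` can be tested. -/
theorem colon_colon_mul_le_divisorialClosure [IsDomain D] {A G : Ideal D} {x : D} (hx : x ≠ 0)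
    (hxA : x ∈ A) :
    (span {x}).colon ((span {x}).colon (A : Set D) : Set D) * G ≤
      (A * G).divisorialClosure := by
  rw [mul_le]
  intro y hy g hg a d hd
  rw [mem_span_singleton_colon] at hy
  have h1 : ∀ α ∈ A, d ∣ a * g * α := fun α hα => by
    have := hd _ (mul_mem_mul hα hg)
    rwa [mul_comm α, ← mul_assoc] at this
  obtain ⟨b, hb⟩ := h1 x hxA
  by_cases hd0 : d = 0
  · subst hd0
    have h2 : a * g = 0 := by
      rw [zero_mul] at hb
      exact (mul_eq_zero.mp hb).resolve_right hx
    rw [mul_comm y, ← mul_assoc, h2, zero_mul]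
  have hbB : b ∈ (span {x}).colon (A : Set D) := by
    rw [mem_span_singleton_colon]
    intro α hα
    obtain ⟨e, he⟩ := h1 α hα
    refine ⟨e, mul_left_cancel₀ hd0 ?_⟩
    linear_combination (-α) * hb + x * he
  obtain ⟨z, hz⟩ := hy b hbB
  refine ⟨z, mul_left_cancel₀ hx ?_⟩
  linear_combination y * hb + d * hz

end Ideal

/-! ### `t`-invertibility of finitely generated ideals -/

/-- Every nonzero finitely generated ideal is `t`-invertible: for `0 ≠ x ∈ A`, the element `x`
lies in the `t`-closure of `A (xD : A) = x A A⁻¹`. -/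
def FGIdealsTInvertible (D : Type*) [CommRing D] : Prop :=
  ∀ (A : Ideal D) (x : D), A.FG → x ∈ A → x ≠ 0 →
    x ∈ (A * (Ideal.span {x}).colon (A : Set D)).tIdeal

-- A finitely generated witness in `A_v B` already lies in `A_v G ⊆ (AG)_v` for some finitely
-- generated `G ⊆ B`. Since `A` is finitely generated, so is `AG`, which is thus a witness inside
-- `AB`.
open Ideal in
theorem fgIdealsTInvertible_of_colon_colon {D : Type*} [CommRing D] [IsDomain D]
    (h : ∀ (A : Ideal D) (x : D), x ∈ A → x ≠ 0 →
      x ∈ ((span {x}).colon ((span {x}).colon (A : Set D) : Set D) *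
        (span {x}).colon (A : Set D)).tIdeal) : FGIdealsTInvertible D := by
  intro A x hA hxA hx
  obtain ⟨L, hL, hLe, hxL⟩ := h A x hxA hx
  obtain ⟨G, hG, hGB, hLG⟩ := exists_fg_of_le_mul hL hLe
  exact ⟨A * G, hA.mul hG, mul_mono_right hGB, divisorialClosure_idem
    (hLG.trans (colon_colon_mul_le_divisorialClosure hx hxA)) hxL⟩

/-! ### Agreement with the closures of fractional ideals -/

section Comparison

variable {D : Type*} [CommRing D] [IsDomain D] {K : Type*} [Field K] [Algebra D K]
  [IsFractionRing D K]

theorem vClosure_coeIdeal (H : Ideal D) :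
    vClosure (H : FractionalIdeal D⁰ K) = (H.divisorialClosure : FractionalIdeal D⁰ K) := by
  by_cases hH : H = ⊥
  · subst hH
    have : (⊥ : Ideal D).divisorialClosure = ⊥ := by
      refine eq_bot_iff.mpr fun x hx => ?_
      -- The test `a = 1`, `d = 0` leaves only the zero element.
      simpa using hx 1 0 (by simp)
    rw [this, FractionalIdeal.coeIdeal_bot, vClosure, FractionalIdeal.inv_zero',
      FractionalIdeal.inv_zero']
  have hH' : (H : FractionalIdeal D⁰ K) ≠ 0 := FractionalIdeal.coeIdeal_ne_zero.mpr hH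
  have hinj := IsFractionRing.injective D K
  have hinv : ∀ a d : D, d ≠ 0 → (algebraMap D K a / algebraMap D K d ∈
      (H : FractionalIdeal D⁰ K)⁻¹ ↔ ∀ h ∈ H, d ∣ a * h) := by
    intro a d hd
    have hd' : algebraMap D K d ≠ 0 := by simpa using hd
    rw [FractionalIdeal.mem_inv_iff hH']
    constructor
    · intro h y hy
      obtain ⟨e, he⟩ := (FractionalIdeal.mem_one_iff _).mp
        (h _ (FractionalIdeal.mem_coeIdeal_of_mem D⁰ hy))
      refine ⟨e, hinj ?_⟩
      rw [map_mul, map_mul, he]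
      field_simp
    · intro h y hy
      obtain ⟨z, hz, rfl⟩ := (FractionalIdeal.mem_coeIdeal _).mp hy
      obtain ⟨e, he⟩ := h z hz
      refine (FractionalIdeal.mem_one_iff _).mpr ⟨e, ?_⟩
      have := congrArg (algebraMap D K) he
      rw [map_mul, map_mul] at this
      field_simp
      rw [this, mul_comm]
  ext x
  rw [vClosure, FractionalIdeal.mem_inv_iff (fractionalIdeal_inv_ne_zero hH'),
    FractionalIdeal.mem_coeIdeal]
  constructor
  · intro h
    -- Since `H ⊆ D`, the element `1` lies in `H⁻¹`; hence `H_v ⊆ D`.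
    have h1 := h (algebraMap D K 1 / algebraMap D K 1) ((hinv 1 1 one_ne_zero).mpr (by simp))
    rw [div_self (by simp), mul_one] at h1
    obtain ⟨y, rfl⟩ := (FractionalIdeal.mem_one_iff _).mp h1
    refine ⟨y, fun a d had => ?_, rfl⟩
    by_cases hd : d = 0
    · subst hd
      obtain ⟨z, hz, hz0⟩ := Submodule.exists_mem_ne_zero_of_ne_bot hH
      have : a = 0 := (mul_eq_zero.mp (zero_dvd_iff.mp (had z hz))).resolve_right hz0
      simp [this]
    · have hd' : algebraMap D K d ≠ 0 := by simpa using hd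
      obtain ⟨e, he⟩ := (FractionalIdeal.mem_one_iff _).mp (h _ ((hinv a d hd).mpr had))
      refine ⟨e, hinj ?_⟩
      rw [map_mul, map_mul, he]
      field_simp
  · rintro ⟨y, hy, rfl⟩ z hz
    obtain ⟨a, d, hd, rfl⟩ := IsFractionRing.div_surjective (A := D) z
    have hd0 : d ≠ 0 := nonZeroDivisors.ne_zero hd
    have hd' : algebraMap D K d ≠ 0 := by simpa using hd0
    obtain ⟨e, he⟩ := hy a d ((hinv a d hd0).mp hz)
    refine (FractionalIdeal.mem_one_iff _).mpr ⟨e, ?_⟩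
    have := congrArg (algebraMap D K) he
    rw [map_mul, map_mul] at this
    field_simp
    rw [mul_comm, ← this, mul_comm]

theorem tClosure_coeIdeal (I : Ideal D) :
    tClosure (I : FractionalIdeal D⁰ K) = (I.tIdeal : FractionalIdeal D⁰ K) := by
  ext x
  rw [FractionalIdeal.mem_coeIdeal]
  have hinj := IsFractionRing.injective D K
  constructor
  · rintro ⟨H, hH, hHI, hx⟩
    obtain ⟨J, rfl⟩ := FractionalIdeal.le_one_iff_exists_coeIdeal.mp
      (hHI.trans FractionalIdeal.coeIdeal_le_one)
    rw [vClosure_coeIdeal, FractionalIdeal.mem_coeIdeal] at hx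
    obtain ⟨y, hy, rfl⟩ := hx
    exact ⟨y, ⟨J, (FractionalIdeal.coeIdeal_fg D⁰ hinj J).mp hH,
      (FractionalIdeal.coeIdeal_le_coeIdeal K).mp hHI, hy⟩, rfl⟩
  · rintro ⟨y, ⟨J, hJ, hJI, hy⟩, rfl⟩
    refine ⟨J, (FractionalIdeal.coeIdeal_fg D⁰ hinj J).mpr hJ,
      (FractionalIdeal.coeIdeal_le_coeIdeal K).mpr hJI, ?_⟩
    rw [vClosure_coeIdeal]
    exact FractionalIdeal.mem_coeIdeal_of_mem D⁰ hy

end Comparison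

/-! ### Polynomials and the multiplicative set `N_v` -/

section Main

variable {D : Type*} [CommRing D] [IsDomain D]

theorem isTSharp_iff :
    IsTSharp D ↔ ∀ I A B : Ideal D, I ≠ ⊥ → A ≠ ⊥ → B ≠ ⊥ → A * B ≤ I →
      ∃ H J : Ideal D, H ≠ ⊥ ∧ J ≠ ⊥ ∧ I.tIdeal = (H * J).tIdeal ∧ A ≤ H.tIdeal ∧
        B ≤ J.tIdeal := by
  simp only [IsTSharp, IsStarSharp, tClosure_coeIdeal, FractionalIdeal.coeIdeal_inj,
    FractionalIdeal.coeIdeal_le_coeIdeal]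

theorem mem_Nv_iff {f : D[X]} :
    f ∈ Nv D ↔ ∀ a d : D, (∀ k, d ∣ a * f.coeff k) → d ∣ a := by
  have hinj := IsFractionRing.injective D (FractionRing D)
  constructor
  · rintro ⟨hf0, hf⟩ a d had
    rw [vClosure_contentIdeal_eq_one_iff hf0] at hf
    by_cases hd : d = 0
    · subst hd
      obtain ⟨k, hk⟩ : ∃ k, f.coeff k ≠ 0 := by
        by_contra! h
        exact hf0 (Polynomial.ext (by simpa using h))
      exact zero_dvd_iff.mpr ((mul_eq_zero.mp (zero_dvd_iff.mp (had k))).resolve_right hk)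
    have hd' : algebraMap D (FractionRing D) d ≠ 0 := by simpa using hd
    obtain ⟨e, he⟩ := hf (algebraMap D _ a / algebraMap D _ d) fun k => by
      obtain ⟨e, he⟩ := had k
      refine ⟨e, ?_⟩
      have := congrArg (algebraMap D (FractionRing D)) he
      rw [map_mul, map_mul] at this
      field_simp
      rw [this, mul_comm]
    refine ⟨e, hinj ?_⟩
    rw [map_mul, he]
    field_simp
  · intro h
    have hf0 : f ≠ 0 := by
      rintro rfl
      -- Allowing `d = 0` in the criterion is what excludes `f = 0`.
      exact one_ne_zero (zero_dvd_iff.mp (h 1 0 (by simp)))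
    refine ⟨hf0, (vClosure_contentIdeal_eq_one_iff hf0).mpr fun x hx => ?_⟩
    obtain ⟨a, d, hd, rfl⟩ := IsFractionRing.div_surjective (A := D) x
    have hd' : algebraMap D (FractionRing D) d ≠ 0 := by simpa using nonZeroDivisors.ne_zero hd
    obtain ⟨e, rfl⟩ := h a d fun k => by
      obtain ⟨e, he⟩ := hx k
      refine ⟨e, hinj ?_⟩
      rw [map_mul, map_mul, he]
      field_simp
    refine ⟨e, ?_⟩
    rw [map_mul]
    field_simp

/-- This is the Gauss-type lemma `mem_range_of_mul_mem_range` applied to `h / x`. -/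
theorem dvd_coeff_of_mem_Nv {s h : D[X]} {x : D} (hs : s ∈ Nv D) (hx : x ≠ 0)
    (hsh : ∀ k, x ∣ (s * h).coeff k) (k : ℕ) : x ∣ h.coeff k := by
  set φ := algebraMap D (FractionRing D)
  have hinj : Function.Injective φ := IsFractionRing.injective D (FractionRing D)
  have hx' : φ x ≠ 0 := by simpa [φ] using hx
  have hs' := (vClosure_contentIdeal_eq_one_iff (K := FractionRing D) hs.1).mp hs.2
  have := mem_range_of_mul_mem_range hs' (h.natDegree + 1) (h.map φ * Polynomial.C (φ x)⁻¹)
    (fun m hm => by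
      rw [Polynomial.coeff_mul_C, Polynomial.coeff_map,
        Polynomial.coeff_eq_zero_of_natDegree_lt hm, map_zero, zero_mul])
    (by
      rw [← mul_assoc, ← Polynomial.map_mul, Polynomial.mem_map_range]
      intro k
      obtain ⟨e, he⟩ := hsh k
      refine ⟨e, ?_⟩
      rw [Polynomial.coeff_mul_C, Polynomial.coeff_map, he, map_mul, mul_comm (φ x),
        mul_inv_cancel_right₀ hx'])
  obtain ⟨e, he⟩ := (Polynomial.mem_map_range _).mp this k
  refine ⟨e, hinj ?_⟩
  rw [Polynomial.coeff_mul_C, Polynomial.coeff_map] at he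
  rw [map_mul, he, mul_comm (φ x), inv_mul_cancel_right₀ hx']

/-- A polynomial `b` with coefficients generating a given finitely generated ideal, spaced out
so that the products of the generators with the coefficients of `f` are coefficients of `f b`. -/
theorem exists_spaced_polynomial {R : Type*} [CommRing R] (f : R[X]) {G : Ideal R} (hG : G.FG) :
    ∃ b : R[X], (∀ k, b.coeff k ∈ G) ∧
      ∀ a e : R, (∀ j, e ∣ a * (f * b).coeff j) → ∀ g ∈ G, ∀ k, e ∣ a * g * f.coeff k := by
  suffices ∀ S : Finset R, ∃ b : R[X], (∀ k, b.coeff k ∈ Ideal.span (S : Set R)) ∧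
      ∀ g ∈ S, ∀ k ≤ f.natDegree, ∃ j, (f * b).coeff j = g * f.coeff k by
    obtain ⟨S, rfl⟩ := hG
    obtain ⟨b, hb, hS⟩ := this S
    refine ⟨b, hb, fun a e he g hg k => ?_⟩
    by_cases hk : k ≤ f.natDegree
    · induction hg using Submodule.span_induction with
      | mem g hg =>
        obtain ⟨j, hj⟩ := hS g hg k hk
        rw [mul_assoc, ← hj]
        exact he j
      | zero => simp
      | add g g' _ _ h h' =>
        rw [mul_add, add_mul]
        exact dvd_add h h'
      | smul r g _ h =>
        rw [smul_eq_mul, mul_left_comm, mul_assoc]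
        exact h.mul_left r
    · simp [Polynomial.coeff_eq_zero_of_natDegree_lt (not_le.mp hk)]
  classical
  intro S
  induction S using Finset.induction_on with
  | empty => exact ⟨0, by simp, by simp⟩
  | insert g S _ ih =>
    obtain ⟨b, hb, hS⟩ := ih
    -- The shift by `deg f + 1` frees the degrees `0, …, deg f` for `g f`, so the two blocks do not
    -- overlap.
    refine ⟨b * Polynomial.X ^ (f.natDegree + 1) + Polynomial.C g, fun k => ?_,
      fun g' hg' k hk => ?_⟩
    · rw [Finset.coe_insert, Ideal.span_insert, Polynomial.coeff_add]
      refine add_mem ?_ ?_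
      · rw [Polynomial.coeff_mul_X_pow']
        split_ifs
        · exact Ideal.mem_sup_right (hb _)
        · exact zero_mem _
      · rw [Polynomial.coeff_C]
        split_ifs
        · exact Ideal.mem_sup_left (Ideal.mem_span_singleton_self g)
        · exact zero_mem _
    · rw [mul_add, ← mul_assoc]
      rcases Finset.mem_insert.mp hg' with rfl | hg'
      · refine ⟨k, ?_⟩
        rw [Polynomial.coeff_add, Polynomial.coeff_mul_X_pow', if_neg (by omega),
          Polynomial.coeff_mul_C, zero_add, mul_comm]
      · obtain ⟨j, hj⟩ := hS g' hg' k hk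
        refine ⟨j + (f.natDegree + 1), ?_⟩
        rw [Polynomial.coeff_add, Polynomial.coeff_mul_X_pow, Polynomial.coeff_mul_C,
          Polynomial.coeff_eq_zero_of_natDegree_lt (by omega : f.natDegree < j + (f.natDegree + 1)),
          zero_mul, add_zero, hj]

open Ideal in
/-- If finitely generated ideals are `t`-invertible, then `f` divides `x q` with `q ∈ N_v` for some
`x ≠ 0`, with a cofactor `b` having coefficients in `x c(f)⁻¹`. -/
theorem FGIdealsTInvertible.exists_mul_eq (hD : FGIdealsTInvertible D) {f : D[X]} (hf : f ≠ 0) :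
    ∃ (x : D) (b q : D[X]), x ≠ 0 ∧ q ∈ Nv D ∧
      (∀ k, ∀ y ∈ f.contentIdeal, x ∣ b.coeff k * y) ∧ f * b = Polynomial.C x * q := by
  obtain ⟨x, hxA, hx⟩ := Submodule.exists_mem_ne_zero_of_ne_bot
    (show f.contentIdeal ≠ ⊥ by simpa using hf)
  obtain ⟨L, hL, hLe, hxL⟩ := hD f.contentIdeal x f.contentIdeal_FG hxA hx
  obtain ⟨G, hG, hGB, hLG⟩ := exists_fg_of_le_mul hL hLe
  obtain ⟨b, hb, hfb⟩ := exists_spaced_polynomial f hG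
  have hbB : ∀ k, ∀ y ∈ f.contentIdeal, x ∣ b.coeff k * y := fun k =>
    mem_span_singleton_colon.mp (hGB (hb k))
  obtain ⟨q, hq⟩ : Polynomial.C x ∣ f * b := by
    rw [Polynomial.C_dvd_iff_dvd_coeff]
    intro k
    rw [Polynomial.coeff_mul]
    refine Finset.dvd_sum fun p _ => ?_
    rw [mul_comm]
    exact hbB _ _ (f.coeff_mem_contentIdeal _)
  -- For `q ∈ N_v`: if `d` divides every `a q_k`, then `dx` divides the coefficients of `a f b`,
  -- hence `a c(f) G` by the spacing, hence `a L`. As `x ∈ L_v`, it divides `a x`, so `d ∣ a`.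
  refine ⟨x, b, q, hx, mem_Nv_iff.mpr fun a d had => ?_, hbB, hq⟩
  have h1 : ∀ g ∈ G, ∀ k, d * x ∣ a * g * f.coeff k := by
    refine hfb a (d * x) fun j => ?_
    rw [hq, Polynomial.coeff_C_mul, mul_left_comm, mul_comm d]
    exact mul_dvd_mul_left x (had j)
  have h2 : ∀ l ∈ L, d * x ∣ a * l := by
    intro l hl
    have : f.contentIdeal * G ≤ (span {d * x}).colon ({a} : Set D) := by
      rw [mul_le]
      intro y hy g hg
      rw [Polynomial.contentIdeal_def] at hy
      have hyg : y ∈ (span {d * x}).colon ({a * g} : Set D) := by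
        refine (span_le.mpr ?_) hy
        intro y hy
        obtain ⟨k, -, rfl⟩ := Polynomial.mem_coeffs_iff.mp hy
        simpa [Submodule.mem_colon, mem_span_singleton, mul_comm] using h1 g hg k
      simp only [Submodule.mem_colon_singleton, smul_eq_mul, mem_span_singleton] at hyg ⊢
      convert hyg using 1
      ring
    simpa [mem_span_singleton, mul_comm] using this (hLG hl)
  exact (mul_dvd_mul_iff_right hx).mp (hxL a (d * x) h2)

/-! ### Extension of ideals to `D[X]_{N_v}` -/

/-- The structure map `D → D[X]_{N_v}`. -/
noncomputable def toNvLocalization (D : Type*) [CommRing D] [IsDomain D] :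
    D →+* Localization (Nv D) :=
  (algebraMap D[X] (Localization (Nv D))).comp Polynomial.C

theorem toNvLocalization_injective : Function.Injective (toNvLocalization D) :=
  (IsLocalization.injective (Localization (Nv D))
    (M := Nv D)
    fun f (hf : f ∈ Nv D) => mem_nonZeroDivisors_of_ne_zero hf.1).comp Polynomial.C_injective

theorem algebraMap_mem_map_toNvLocalization_iff {I : Ideal D} {f : D[X]} :
    algebraMap D[X] (Localization (Nv D)) f ∈ I.map (toNvLocalization D) ↔
      ∃ s ∈ Nv D, ∀ k, (s * f).coeff k ∈ I := by
  rw [toNvLocalization, ← Ideal.map_map, IsLocalization.algebraMap_mem_map_algebraMap_iff (Nv D)]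
  simp only [Ideal.mem_map_C_iff]

theorem exists_mul_algebraMap_eq (z : Localization (Nv D)) :
    ∃ (f s : D[X]), IsUnit (algebraMap D[X] (Localization (Nv D)) s) ∧
      z * algebraMap D[X] _ s = algebraMap D[X] _ f := by
  obtain ⟨⟨f, s⟩, h⟩ := IsLocalization.surj (Nv D) z
  exact ⟨f, s, IsLocalization.map_units _ s, h⟩

theorem le_map_toNvLocalization {A : Ideal (Localization (Nv D))} {I : Ideal D}
    (h : ∀ f, algebraMap D[X] _ f ∈ A → ∀ k, f.coeff k ∈ I) : A ≤ I.map (toNvLocalization D) := by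
  intro z hz
  obtain ⟨f, s, hs, hfs⟩ := exists_mul_algebraMap_eq z
  rw [← Ideal.mul_unit_mem_iff_mem _ hs, hfs, algebraMap_mem_map_toNvLocalization_iff]
  refine ⟨1, one_mem _, ?_⟩
  rw [one_mul]
  exact h f (hfs ▸ A.mul_mem_right _ hz)

-- The content of `s x` is the finitely generated witness: if `d` divides all `a x s_k`, then `d ∣ a
-- x` because `s ∈ N_v`.
open Ideal in
theorem mem_tIdeal_of_mem_Nv {I : Ideal D} {s : D[X]} {x : D} (hs : s ∈ Nv D)
    (hsx : ∀ k, (s * Polynomial.C x).coeff k ∈ I) : x ∈ I.tIdeal := by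
  refine ⟨(s * Polynomial.C x).contentIdeal, Polynomial.contentIdeal_FG _, ?_, fun a d had => ?_⟩
  · rw [Polynomial.contentIdeal_def, span_le]
    intro y hy
    obtain ⟨k, -, rfl⟩ := Polynomial.mem_coeffs_iff.mp hy
    exact hsx k
  · refine mem_Nv_iff.mp hs _ _ fun k => ?_
    have := had _ (Polynomial.coeff_mem_contentIdeal _ k)
    rwa [Polynomial.coeff_mul_C, mul_comm (s.coeff k), ← mul_assoc] at this

/-! ### Sharpness forces `t`-invertibility -/

open Ideal in
theorem fgIdealsTInvertible_of_isTSharp (hD : IsTSharp D) : FGIdealsTInvertible D := by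
  rw [isTSharp_iff] at hD
  refine fgIdealsTInvertible_of_colon_colon fun A x hxA hx => ?_
  set B := (span {x}).colon (A : Set D)
  have hAB : A * B ≤ span {x} := mul_span_singleton_colon_le A x
  have hxB : x ∈ B := mem_span_singleton_colon.mpr fun a _ => dvd_mul_right x a
  obtain ⟨H, J, -, -, hHJ, hAH, hBJ⟩ := hD (span {x}) A B (by simpa using hx)
    (Submodule.ne_bot_iff _ |>.mpr ⟨x, hxA, hx⟩) (Submodule.ne_bot_iff _ |>.mpr ⟨x, hxB, hx⟩) hAB
  have hdvd : ∀ h ∈ H, ∀ j ∈ J, x ∣ h * j := by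
    intro h hh j hj
    have h1 : h * j ∈ (span {x}).tIdeal := hHJ ▸ le_tIdeal _ (mul_mem_mul hh hj)
    have := dvd_mul_of_mem_tIdeal (c := 1) (x := x)
      (fun i hi => by rw [one_mul]; exact mem_span_singleton.mp hi) h1
    rwa [one_mul] at this
  have hxt : x ∈ (H * J).tIdeal := hHJ ▸ le_tIdeal _ (mem_span_singleton_self x)
  -- From `HJ ⊆ xD`, `B ⊆ J_t` and `A ⊆ H_t` follow `H ⊆ (xD : B)` and `J ⊆ (xD : A) = B`.
  refine tIdeal_mono (mul_mono (fun h hh => ?_) fun j hj => ?_) hxt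
  · exact mem_span_singleton_colon.mpr fun b hb => dvd_mul_of_mem_tIdeal (hdvd h hh) (hBJ hb)
  · refine mem_span_singleton_colon.mpr fun a ha => dvd_mul_of_mem_tIdeal (fun h hh => ?_) (hAH ha)
    rw [mul_comm]
    exact hdvd h hh j hj

open Ideal in
/-- If `x R = A' B'` in `R = D[X]_{N_v}`, then `A' ⊆ (xD : B) R` for every ideal `B` of `D`
contained in `B'`. -/
theorem le_map_colon_of_mul_le {A' B' : Ideal (Localization (Nv D))} {B : Ideal D} {x : D}
    (hx : x ≠ 0) (hB : B.map (toNvLocalization D) ≤ B')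
    (h : A' * B' ≤ (span {x}).map (toNvLocalization D)) :
    A' ≤ ((span {x}).colon (B : Set D)).map (toNvLocalization D) := by
  refine le_map_toNvLocalization fun f hf k => mem_span_singleton_colon.mpr fun b hb => ?_
  have h1 := h (mul_mem_mul hf (hB (mem_map_of_mem _ hb)))
  rw [toNvLocalization, RingHom.comp_apply, ← map_mul, ← toNvLocalization,
    algebraMap_mem_map_toNvLocalization_iff] at h1
  obtain ⟨s, hs, hsf⟩ := h1
  rw [← Polynomial.coeff_mul_C]
  exact dvd_coeff_of_mem_Nv hs hx (fun k => mem_span_singleton.mp (hsf k)) k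

open Ideal in
theorem fgIdealsTInvertible_of_isSharp (hR : IsSharp (Localization (Nv D))) :
    FGIdealsTInvertible D := by
  refine fgIdealsTInvertible_of_colon_colon fun A x hxA hx => ?_
  set B := (span {x}).colon (A : Set D)
  have hAB : A * B ≤ span {x} := mul_span_singleton_colon_le A x
  have hxB : x ∈ B := mem_span_singleton_colon.mpr fun a _ => dvd_mul_right x a
  have hne : ∀ I : Ideal D, x ∈ I → I.map (toNvLocalization D) ≠ ⊥ := fun I hI =>
    Submodule.ne_bot_iff _ |>.mpr ⟨_, mem_map_of_mem _ hI,
      (map_ne_zero_iff _ toNvLocalization_injective).mpr hx⟩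
  obtain ⟨A', B', hA', hB', heq⟩ := hR ((span {x}).map (toNvLocalization D))
    (A.map (toNvLocalization D)) (B.map (toNvLocalization D))
    (hne _ (mem_span_singleton_self x)) (hne _ hxA) (hne _ hxB)
    (by rw [← Ideal.map_mul]; exact map_mono hAB)
  have h1 := le_map_colon_of_mul_le hx hB' heq.ge
  have h2 := le_map_colon_of_mul_le hx hA' ((mul_comm B' A').le.trans heq.ge)
  have h3 : toNvLocalization D x ∈ ((span {x}).colon (B : Set D) * B).map (toNvLocalization D) := by
    rw [Ideal.map_mul]
    exact mul_mono h1 h2 (heq.le (mem_map_of_mem _ (mem_span_singleton_self x)))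
  rw [toNvLocalization, RingHom.comp_apply, ← toNvLocalization,
    algebraMap_mem_map_toNvLocalization_iff] at h3
  obtain ⟨s, hs, hsx⟩ := h3
  exact mem_tIdeal_of_mem_Nv hs hsx

/-! ### Ideal correspondence and transfer of sharpness -/

open Ideal in
/-- Extending to `D[X]_{N_v}` and contracting back is the `t`-closure. -/
theorem FGIdealsTInvertible.comap_map (hD : FGIdealsTInvertible D) (I : Ideal D) :
    (I.map (toNvLocalization D)).comap (toNvLocalization D) = I.tIdeal := by
  ext y
  rw [mem_comap, toNvLocalization, RingHom.comp_apply, ← toNvLocalization,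
    algebraMap_mem_map_toNvLocalization_iff]
  constructor
  · rintro ⟨s, hs, hsy⟩
    exact mem_tIdeal_of_mem_Nv hs hsy
  · rintro ⟨H, hH, hHI, hy⟩
    -- Spacing against `1` yields a polynomial with coefficients in `H` whose content has the same
    -- `v`-closure as `H`.
    obtain ⟨f, hfH, hf⟩ := exists_spaced_polynomial 1 hH
    have hHf : ∀ a d : D, (∀ h ∈ f.contentIdeal, d ∣ a * h) → ∀ h ∈ H, d ∣ a * h := by
      intro a d had h hh
      have := hf a d (fun j => by
        rw [one_mul]
        exact had _ (f.coeff_mem_contentIdeal j)) h hh 0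
      rwa [Polynomial.coeff_one_zero, mul_one] at this
    by_cases hf0 : f = 0
    · subst hf0
      have : y = 0 := by
        simpa using hy 1 0 (hHf 1 0 (by simp))
      exact ⟨1, one_mem _, by simp [this]⟩
    · obtain ⟨x, b, q, hx, hq, hb, hfb⟩ := hD.exists_mul_eq hf0
      obtain ⟨w, hw⟩ : Polynomial.C x ∣ b * Polynomial.C y := by
        rw [Polynomial.C_dvd_iff_dvd_coeff]
        intro k
        rw [Polynomial.coeff_mul_C]
        exact hy _ _ (hHf _ _ (hb k))
      -- Up to the unit `q` of the localization, `y` is a multiple of `f`, whose coefficients lie in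
      -- `I`.
      have hqy : q * Polynomial.C y = f * w := by
        refine mul_left_cancel₀ (Polynomial.C_ne_zero.mpr hx) ?_
        rw [← mul_assoc, ← hfb, mul_assoc, hw, mul_left_comm]
      refine ⟨q, hq, fun k => ?_⟩
      rw [hqy, Polynomial.coeff_mul]
      exact sum_mem fun p _ => I.mul_mem_right _ (hHI (hfH _))

open Ideal in
/-- Every ideal of `D[X]_{N_v}` is extended from `D`. -/
theorem FGIdealsTInvertible.map_comap (hD : FGIdealsTInvertible D)
    (A : Ideal (Localization (Nv D))) :
    (A.comap (toNvLocalization D)).map (toNvLocalization D) = A := by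
  refine le_antisymm map_comap_le (le_map_toNvLocalization fun f hf k => ?_)
  by_cases hf0 : f = 0
  · simp [hf0]
  obtain ⟨x, b, q, hx, hq, hb, hfb⟩ := hD.exists_mul_eq hf0
  obtain ⟨w, hw⟩ : Polynomial.C x ∣ b * Polynomial.C (f.coeff k) := by
    rw [Polynomial.C_dvd_iff_dvd_coeff]
    intro j
    rw [Polynomial.coeff_mul_C]
    exact hb j _ (f.coeff_mem_contentIdeal k)
  -- Since `q` becomes a unit, each coefficient of `f` lies in any ideal of the localization
  -- containing `f`.
  have hqf : Polynomial.C (f.coeff k) * q = f * w := by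
    refine mul_left_cancel₀ (Polynomial.C_ne_zero.mpr hx) ?_
    rw [mul_left_comm, ← hfb, mul_left_comm (Polynomial.C x), ← hw]
    ring
  have hu := IsLocalization.map_units (Localization (Nv D)) (⟨q, hq⟩ : Nv D)
  rw [mem_comap, ← A.mul_unit_mem_iff_mem hu, toNvLocalization, RingHom.comp_apply, ← map_mul, hqf,
    map_mul]
  exact A.mul_mem_right _ hf

open Ideal in
theorem FGIdealsTInvertible.map_le_map_iff (hD : FGIdealsTInvertible D) {I J : Ideal D} :
    I.map (toNvLocalization D) ≤ J.map (toNvLocalization D) ↔ I ≤ J.tIdeal := by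
  rw [map_le_iff_le_comap, hD.comap_map]

open Ideal in
theorem FGIdealsTInvertible.map_eq_map_iff (hD : FGIdealsTInvertible D) {I J : Ideal D} :
    I.map (toNvLocalization D) = J.map (toNvLocalization D) ↔ I.tIdeal = J.tIdeal := by
  rw [← hD.comap_map, ← hD.comap_map]
  refine ⟨fun h => by rw [h], fun h => ?_⟩
  rw [← hD.map_comap (I.map _), h, hD.map_comap]

theorem Ideal.map_toNvLocalization_eq_bot_iff {I : Ideal D} :
    I.map (toNvLocalization D) = ⊥ ↔ I = ⊥ :=
  Ideal.map_eq_bot_iff_of_injective toNvLocalization_injective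

theorem FGIdealsTInvertible.isTSharp_iff_isSharp (hD : FGIdealsTInvertible D) :
    IsTSharp D ↔ IsSharp (Localization (Nv D)) := by
  rw [isTSharp_iff]
  constructor
  · intro h I' A' B' hI hA hB hAB
    obtain ⟨I, rfl⟩ : ∃ I : Ideal D, I.map (toNvLocalization D) = I' := ⟨_, hD.map_comap I'⟩
    obtain ⟨A, rfl⟩ : ∃ A : Ideal D, A.map (toNvLocalization D) = A' := ⟨_, hD.map_comap A'⟩
    obtain ⟨B, rfl⟩ : ∃ B : Ideal D, B.map (toNvLocalization D) = B' := ⟨_, hD.map_comap B'⟩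
    rw [← Ideal.map_mul, hD.map_le_map_iff] at hAB
    -- Contraction gives only `AB ⊆ I_t`, so `t`-sharpness is applied to `I_t`, which has the same
    -- extension as `I`.
    have hIt : I.tIdeal.map (toNvLocalization D) = I.map (toNvLocalization D) := by
      rw [← hD.comap_map, hD.map_comap]
    rw [Ne, Ideal.map_toNvLocalization_eq_bot_iff] at hA hB
    rw [← hIt, Ne, Ideal.map_toNvLocalization_eq_bot_iff] at hI
    obtain ⟨H, J, -, -, hHJ, hAH, hBJ⟩ := h _ A B hI hA hB hAB
    refine ⟨H.map _, J.map _, hD.map_le_map_iff.mpr hAH, hD.map_le_map_iff.mpr hBJ, ?_⟩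
    rw [← Ideal.map_mul, ← hIt, hD.map_eq_map_iff, hHJ]
  · intro h I A B hI hA hB hAB
    obtain ⟨A', B', hA', hB', heq⟩ := h (I.map (toNvLocalization D)) (A.map (toNvLocalization D))
      (B.map (toNvLocalization D)) (by rwa [Ne, Ideal.map_toNvLocalization_eq_bot_iff])
      (by rwa [Ne, Ideal.map_toNvLocalization_eq_bot_iff])
      (by rwa [Ne, Ideal.map_toNvLocalization_eq_bot_iff])
      (by rw [← Ideal.map_mul]; exact Ideal.map_mono hAB)
    refine ⟨A'.comap (toNvLocalization D), B'.comap (toNvLocalization D), ?_, ?_, ?_, ?_, ?_⟩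
    · exact ne_bot_of_le_ne_bot hA (Ideal.map_le_iff_le_comap.mp hA')
    · exact ne_bot_of_le_ne_bot hB (Ideal.map_le_iff_le_comap.mp hB')
    · rw [← hD.map_eq_map_iff, heq, Ideal.map_mul, hD.map_comap, hD.map_comap]
    · rwa [← hD.map_le_map_iff, hD.map_comap]
    · rwa [← hD.map_le_map_iff, hD.map_comap]

end Main

theorem mainTheorem11 (D : Type*) [CommRing D] [IsDomain D] :
    IsTSharp D ↔ IsSharp (Localization (Nv D)) :=
  ⟨fun h => (fgIdealsTInvertible_of_isTSharp h).isTSharp_iff_isSharp.mp h,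
    fun h => (fgIdealsTInvertible_of_isSharp h).isTSharp_iff_isSharp.mpr h⟩
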